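/- Consider a library of $N$ files of $B$ bits each and a single-stream broadcast channel: a transmitter that knows the library sends bits over one noiseless link, which carries one file ($B$ bits) per unit of time and is received by all of $K_1+K_2\le N$ users. Each of $K_1$ users has a cache of normalized size $\gamma_1\in(0,1)$, that is, of at most $\gamma_1NB$ bits, and the other $K_2$ users have no cache. Placement is uncoded: before the demands are known, each cache is filled with a set of bits of the library. Then every user requests one file, different users requesting different files; the transmitter sends a message depending on the demand and the library, and every user must recover its file from that message and its own cache. The delay of a scheme is the length of the message divided by $B$, maximized over all demand vectors with distinct entries, and the optimal delay $T_1(K_1,\gamma_1,K_2,0)$ is the infimum of the delays of all such schemes over all file sizes $B\ge 1$. If $K_1\gamma_1$ is an integer, then $$T_1(K_1,\gamma_1,K_2,0)=\frac{K_1(1-\gamma_1)}{1+K_1\gamma_1}+K_2,$$ and the infimum is attained. For general $\gamma_1\in(0,1)$, $$T_1(K_1,\gamma_1,K_2,0)=g(K_1\gamma_1)+K_2,$$ where $g:[0,K_1]\to\mathbb R$ is the lower convex envelope of the points $\bigl(t,\tfrac{K_1-t}{1+t}\bigr)$, $t=0,1,\dots,K_1$. Both values of the optimal delay stay the same if, instead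 of error-free recovery, one only asks for recovery with vanishing error probability, i.e. if the optimal delay is the infimum of all $T$ such that for every $\varepsilon>0$ and all sufficiently large $B$ there is a scheme of delay at most $T$ in which, for every demand vector with distinct entries and a uniformly random library, some user fails to recover its file with probability at most $\varepsilon$. -/

import Mathlib

/-- A realization of a library of `N` files, each consisting of `B` bits. -/
abbrev Library (N B : ℕ) : Type := Fin N → Fin B → Bool

/-- A caching and delivery scheme with uncoded placement for the users `ι`, where the cache of
user `k` has normalized size `γ k` (a fraction of the whole library of `N` files of `B` bits).

* Placement is uncoded and made before the demands are known: user `k` stores a set of library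
  bits, at most `γ k * N * B` of them.
* A demand `d : ι ↪ Fin N` lets every user ask for one file, different users for different files.
* For the demand `d`, the transmitter broadcasts `len d` bits (an arbitrary function of the
  library) over a noiseless link that all users receive.
* User `k` estimates its file from the broadcast bits and from the bits in its own cache. -/
structure CachingScheme {ι : Type} (N B : ℕ) (γ : ι → ℝ) where
  cache : ι → Finset (Fin N × Fin B)
  card_cache_le : ∀ k, ((cache k).card : ℝ) ≤ γ k * (N * B)
  len : (ι ↪ Fin N) → ℕ
  encode : (d : ι ↪ Fin N) → Library N B → (Fin (len d) → Bool)
  decode : (d : ι ↪ Fin N) → (k : ι) → (Fin (len d) → Bool) → (cache k → Bool) →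
    (Fin B → Bool)

namespace CachingScheme

variable {ι : Type} {N B : ℕ} {γ : ι → ℝ}

/-- What user `k` decodes when the demand is `d` and the library is `W`. -/
def output (S : CachingScheme N B γ) (d : ι ↪ Fin N) (W : Library N B) (k : ι) :
    Fin B → Bool :=
  S.decode d k (S.encode d W) (fun b => W b.1.1 b.1.2)

/-- Every user recovers its requested file, for every demand and every library. -/
def IsZeroError (S : CachingScheme N B γ) : Prop :=
  ∀ (d : ι ↪ Fin N) (W : Library N B) (k : ι), S.output d W k = W (d k)

/-- The probability, for a uniformly distributed library, that some user does not recover its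
requested file when the demand is `d`. -/
noncomputable def errorProb (S : CachingScheme N B γ) (d : ι ↪ Fin N) : ℝ :=
  (Nat.card {W : Library N B // ∃ k, S.output d W k ≠ W (d k)} : ℝ) / Nat.card (Library N B)

/-- The worst-case delay over all demands of distinct files, where the link carries one file
(that is, `B` bits) per unit of time. -/
noncomputable def delay (S : CachingScheme N B γ) : ℝ :=
  ⨆ d : ι ↪ Fin N, (S.len d : ℝ) / B

end CachingScheme

/-- The worst-case delays of the zero-error schemes with uncoded placement, for all positive file
sizes. -/
def zeroErrorDelays {ι : Type} (N : ℕ) (γ : ι → ℝ) : Set ℝ :=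
  {T | ∃ B : ℕ, 0 < B ∧ ∃ S : CachingScheme N B γ, S.IsZeroError ∧ S.delay = T}

/-- The delays achievable with vanishing error probability: for every `ε > 0` and every large
enough file size there is a scheme with uncoded placement whose worst-case delay is at most `T`
and whose error probability is at most `ε` for every demand. -/
def achievableDelays {ι : Type} (N : ℕ) (γ : ι → ℝ) : Set ℝ :=
  {T | ∀ ε : ℝ, 0 < ε → ∀ᶠ B : ℕ in Filter.atTop,
    ∃ S : CachingScheme N B γ, S.delay ≤ T ∧ ∀ d, S.errorProb d ≤ ε}

/-- `K₁` users with caches of normalized size `γ₁`, and `K₂` users without a cache. -/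
def cacheSizes (K₁ K₂ : ℕ) (γ₁ : ℝ) : Fin K₁ ⊕ Fin K₂ → ℝ :=
  Sum.elim (fun _ => γ₁) (fun _ => 0)

/-- The lower convex envelope of the points `(t, (K₁ - t) / (1 + t))`, `t = 0, 1, …, K₁`,
evaluated at `x`: the lowest height of a point of their convex hull above `x`. -/
noncomputable def delayEnvelope (K₁ : ℕ) (x : ℝ) : ℝ :=
  sInf {y : ℝ | (x, y) ∈ convexHull ℝ
    {p : ℝ × ℝ | ∃ t : ℕ, t ≤ K₁ ∧ p = ((t : ℝ), ((K₁ : ℝ) - t) / (1 + t))}}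

/-!
Write `f t = (K₁ - t) / (1 + t)`, and let `delayEnvelope` be the lower convex envelope of `f` on
`0, …, K₁`.

**Converse.** Fix a demand and let the users decode one after the other. Let `A` be the set of
those requested bits `(d u, b)` that are cached neither by `u` nor by a user before `u`
(`acyclicBits`). Every bit of `A` in the cache of `u` belongs to a file decoded before, so the
message together with the bits outside `A` determines the whole library, provided that every user
decodes correctly (`library_eq_of_encode_eq`). Counting the libraries that are decoded correctly
(`card_correct_mul_le`) gives a message of at least `#A` bits for error-free recovery, and of at
least `#A - 1` bits if the error probability is at most `1 / 2`; the one bit disappears after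
division by `B → ∞`. No entropy inequality is needed.

The users without a cache come first in the order, and their whole files lie in `A`. Average over
all demands and all orders of the other users. A bit cached by a set of `s` users is counted once
for every requesting user who precedes all of them, and by symmetry a user outside the set does so
with probability `1 / (1 + s)`. So the average of `#A` is `K₂ B` plus the sum of `f s` over all
bits, divided by `N` (`sum_bits_le`). The uniform average of the points `(s, f s)` over the `N B`
bits lies in the convex hull defining the envelope, its abscissa is at most `K₁ γ₁` by the sizes of
the caches, and the envelope is decreasing (`delayEnvelope_add_le_delay`).

**Achievability.** Index the bits of a subfile of level `t` by the sets of `t` users with a cache,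
each of which caches that bit. For every set of `t + 1` users, one transmitted bit serves all of
them at once (`codedScheme`). This takes `K₁.choose (t + 1) = K₁.choose t * f t` bits for a subfile
of `K₁.choose t` bits, so one level attains `f t + K₂` if `K₁ γ₁ = t`. In general, the files are
split among several levels in the proportions of a convex combination that represents a point close
to the envelope; rounding leaves boundedly many bits, which are sent uncached
(`eventually_exists_isZeroError`).
-/

/-! ### Averages over permutations and embeddings -/

/-- Each element of `T` is equally often the first one of `T` in a uniformly random order. -/
theorem card_mul_card_perm_first {K : ℕ} (T : Finset (Fin K)) {w : Fin K} (hw : w ∈ T) :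
    T.card * (Finset.univ.filter
      fun π : Equiv.Perm (Fin K) => ∀ v ∈ T, π w ≤ π v).card = K.factorial := by
  classical
  have hsame : ∀ w' ∈ T,
      (Finset.univ.filter fun π : Equiv.Perm (Fin K) => ∀ v ∈ T, π w' ≤ π v).card =
        (Finset.univ.filter fun π : Equiv.Perm (Fin K) => ∀ v ∈ T, π w ≤ π v).card := by
    intro w' hw'
    have hswap : ∀ v ∈ T, Equiv.swap w w' v ∈ T := by
      intro v hv
      by_cases h1 : v = w
      · simpa [h1] using hw'
      by_cases h2 : v = w'
      · simpa [h2] using hw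
      · rwa [Equiv.swap_apply_of_ne_of_ne h1 h2]
    refine Finset.card_equiv (Equiv.mulRight (Equiv.swap w w')) fun π => ?_
    simp only [Finset.mem_filter, Finset.mem_univ, true_and, Equiv.coe_mulRight,
      Equiv.Perm.mul_apply, Equiv.swap_apply_left]
    refine ⟨fun h v hv => h _ (hswap v hv), fun h v hv => ?_⟩
    simpa using h _ (hswap v hv)
  have hcover : (Finset.univ : Finset (Equiv.Perm (Fin K))) = T.biUnion fun w' =>
      Finset.univ.filter fun π : Equiv.Perm (Fin K) => ∀ v ∈ T, π w' ≤ π v := by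
    ext π
    obtain ⟨x, hx, hmin⟩ := T.exists_min_image π ⟨w, hw⟩
    simp only [Finset.mem_univ, Finset.mem_biUnion, Finset.mem_filter, true_and, true_iff]
    exact ⟨x, hx, hmin⟩
  have hcard := congrArg Finset.card hcover
  rw [Finset.card_biUnion, Finset.sum_congr rfl hsame, Finset.sum_const, smul_eq_mul,
    Finset.card_univ, Fintype.card_perm, Fintype.card_fin] at hcard
  · exact hcard.symm
  · intro x hx y hy hxy
    refine Finset.disjoint_left.mpr fun π hπx hπy => hxy ?_
    simp only [Finset.mem_filter, Finset.mem_univ, true_and] at hπx hπy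
    exact π.injective (le_antisymm (hπx y hy) (hπy x hx))

/-- In a random order, the expected number of elements that come before all of `S` is
`(K - #S) / (1 + #S)`. -/
theorem sum_perm_sum_before {K : ℕ} (S : Finset (Fin K)) :
    ∑ π : Equiv.Perm (Fin K), ∑ u : Fin K, (if ∀ v, π v ≤ π u → v ∉ S then (1 : ℝ) else 0) =
      K.factorial * (((K : ℝ) - S.card) / (1 + S.card)) := by
  classical
  rw [Finset.sum_comm]
  have hterm : ∀ u : Fin K,
      ∑ π : Equiv.Perm (Fin K), (if ∀ v, π v ≤ π u → v ∉ S then (1 : ℝ) else 0) =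
        if u ∈ Sᶜ then (K.factorial : ℝ) / (1 + S.card) else 0 := by
    intro u
    rw [Finset.sum_boole]
    by_cases hu : u ∈ S
    · rw [if_neg (by simpa using hu), Finset.filter_eq_empty_iff.mpr]
      · simp
      · exact fun π _ h => h u le_rfl hu
    · rw [if_pos (by simpa using hu)]
      have h := card_mul_card_perm_first (insert u S) (Finset.mem_insert_self u S)
      rw [Finset.card_insert_of_notMem hu] at h
      have hset : (Finset.univ.filter fun π : Equiv.Perm (Fin K) =>
          ∀ v, π v ≤ π u → v ∉ S) = Finset.univ.filter fun π : Equiv.Perm (Fin K) =>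
          ∀ v ∈ insert u S, π u ≤ π v := by
        refine Finset.filter_congr fun π _ => ⟨fun h v hv => ?_, fun h v hle hv => ?_⟩
        · rcases Finset.mem_insert.mp hv with rfl | hv
          · exact le_rfl
          · exact (not_le.mp fun hle => h v hle hv).le
        · have := π.injective (le_antisymm hle (h v (Finset.mem_insert_of_mem hv)))
          exact hu (this ▸ hv)
      rw [hset, eq_div_iff (by positivity), ← h]
      push_cast
      ring
  rw [Finset.sum_congr rfl fun u _ => hterm u, Finset.sum_ite_mem, Finset.univ_inter,
    Finset.sum_const, Finset.card_compl, Fintype.card_fin, nsmul_eq_mul,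
    Nat.cast_sub (by simpa using S.card_le_univ)]
  ring

/-- The value of a random embedding at a fixed point is uniformly distributed. -/
theorem mul_sum_embedding_apply {ι : Type} [Fintype ι] {N : ℕ} (u : ι) (F : Fin N → ℝ) :
    (N : ℝ) * ∑ d : ι ↪ Fin N, F (d u) = Fintype.card (ι ↪ Fin N) * ∑ n, F n := by
  classical
  -- Shifting the values cyclically does not change the sum over embeddings.
  have hperm : ∀ c : Fin N, ∑ d : ι ↪ Fin N, F (d u) = ∑ d : ι ↪ Fin N, F (d u + c) := by
    intro c
    rcases N.eq_zero_or_pos with rfl | hN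
    · exact c.elim0
    have : NeZero N := ⟨hN.ne'⟩
    exact (Equiv.sum_comp ((Equiv.embeddingCongr (Equiv.refl ι) (Equiv.addRight c)))
      fun d : ι ↪ Fin N => F (d u)).symm
  have hsum : ∑ _c : Fin N, ∑ d : ι ↪ Fin N, F (d u) =
      ∑ c : Fin N, ∑ d : ι ↪ Fin N, F (d u + c) :=
    Finset.sum_congr rfl fun c _ => hperm c
  rw [Finset.sum_const, Finset.card_univ, Fintype.card_fin, nsmul_eq_mul] at hsum
  rw [hsum, Finset.sum_comm]
  have hrow : ∀ d : ι ↪ Fin N, ∑ c, F (d u + c) = ∑ n, F n := by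
    intro d
    have : NeZero N := ⟨(Nat.zero_le _).trans_lt (d u).isLt |>.ne'⟩
    exact Equiv.sum_comp (Equiv.addLeft (d u)) F
  rw [Finset.sum_congr rfl fun d _ => hrow d, Finset.sum_const, Finset.card_univ, nsmul_eq_mul]

/-! ### The acyclic lower bound on the length of the message -/

namespace CachingScheme

variable {ι : Type} {N B : ℕ} {γ : ι → ℝ}

open Classical in
/-- Rank the users by `r`. These are the bits of requested files that neither the user requesting
the file nor any user of the same or a smaller rank has cached. -/
noncomputable def acyclicBits (S : CachingScheme N B γ) (d : ι ↪ Fin N) (r : ι → ℕ) :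
    Finset (Fin N × Fin B) :=
  Finset.univ.filter fun p => ∃ u, d u = p.1 ∧ ∀ v, r v ≤ r u → p ∉ S.cache v

theorem mem_acyclicBits {S : CachingScheme N B γ} {d : ι ↪ Fin N} {r : ι → ℕ}
    {p : Fin N × Fin B} :
    p ∈ S.acyclicBits d r ↔ ∃ u, d u = p.1 ∧ ∀ v, r v ≤ r u → p ∉ S.cache v := by
  simp [acyclicBits]

/-- The message and the bits outside `acyclicBits` determine the library as long as every user
decodes correctly: the users recover their files one after the other, in the order of their
ranks. -/
theorem library_eq_of_encode_eq (S : CachingScheme N B γ) (d : ι ↪ Fin N) (r : ι → ℕ)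
    {W W' : Library N B} (hW : ∀ k, S.output d W k = W (d k))
    (hW' : ∀ k, S.output d W' k = W' (d k)) (hX : S.encode d W = S.encode d W')
    (hout : ∀ p ∉ S.acyclicBits d r, W p.1 p.2 = W' p.1 p.2) : W = W' := by
  have hfile : ∀ m u, r u = m → W (d u) = W' (d u) := by
    intro m
    induction m using Nat.strong_induction_on with
    | _ m ih =>
      rintro u rfl
      rw [← hW u, ← hW' u, output, output, hX]
      congr 1
      funext p
      by_cases hp : p.1 ∈ S.acyclicBits d r
      · obtain ⟨u', hu', hr⟩ := mem_acyclicBits.mp hp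
        have hlt : r u' < r u := not_le.mp fun hle => hr u hle p.2
        rw [← hu', ih _ hlt u' rfl]
      · exact hout _ hp
  funext n b
  by_cases hp : (n, b) ∈ S.acyclicBits d r
  · obtain ⟨u, hu, -⟩ := mem_acyclicBits.mp hp
    rw [← show d u = n from hu, hfile _ u rfl]
  · exact hout (n, b) hp

theorem card_correct_mul_le (S : CachingScheme N B γ) (d : ι ↪ Fin N) (r : ι → ℕ) :
    Nat.card {W : Library N B // ∀ k, S.output d W k = W (d k)} *
      2 ^ (S.acyclicBits d r).card ≤ 2 ^ S.len d * Nat.card (Library N B) := by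
  classical
  set A := S.acyclicBits d r
  have hinj : Function.Injective
      (fun W : {W : Library N B // ∀ k, S.output d W k = W (d k)} =>
        ((S.encode d W.1, fun p => W.1 p.1.1 p.1.2) :
          (Fin (S.len d) → Bool) × ({p : Fin N × Fin B // p ∉ A} → Bool))) := by
    intro W W' h
    refine Subtype.ext (S.library_eq_of_encode_eq d r W.2 W'.2 (congrArg Prod.fst h) ?_)
    exact fun p hp => congrFun (congrArg Prod.snd h) ⟨p, hp⟩
  have hle := Nat.card_le_card_of_injective _ hinj
  have hA : A.card ≤ N * B := by simpa using A.card_le_univ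
  have hcompl : Fintype.card {p : Fin N × Fin B // p ∉ A} = N * B - A.card := by
    rw [Fintype.card_subtype_compl]; simp
  have hlib : Nat.card (Library N B) = 2 ^ (N * B) := by
    simp [Library, Nat.card_eq_fintype_card, ← pow_mul, mul_comm]
  rw [Nat.card_prod, Nat.card_eq_fintype_card (α := Fin (S.len d) → Bool),
    Nat.card_eq_fintype_card (α := {p : Fin N × Fin B // p ∉ A} → Bool), Fintype.card_fun,
    Fintype.card_fun, hcompl, Fintype.card_bool, Fintype.card_fin] at hle
  calc _ ≤ 2 ^ S.len d * 2 ^ (N * B - A.card) * 2 ^ A.card := Nat.mul_le_mul_right _ hle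
    _ = _ := by rw [mul_assoc, ← pow_add, Nat.sub_add_cancel hA, hlib]

theorem IsZeroError.card_acyclicBits_le {S : CachingScheme N B γ} (hS : S.IsZeroError)
    (d : ι ↪ Fin N) (r : ι → ℕ) : (S.acyclicBits d r).card ≤ S.len d := by
  have h := S.card_correct_mul_le d r
  rw [Nat.card_congr (Equiv.subtypeUnivEquiv fun W => hS d W), mul_comm] at h
  exact (Nat.pow_le_pow_iff_right one_lt_two).mp (Nat.le_of_mul_le_mul_right h Nat.card_pos)

/-- Even recovery with probability one half costs at most a single bit less than error-free
recovery. -/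
theorem card_acyclicBits_le_of_errorProb_le (S : CachingScheme N B γ) (d : ι ↪ Fin N)
    (r : ι → ℕ) (hS : S.errorProb d ≤ 1 / 2) : (S.acyclicBits d r).card ≤ S.len d + 1 := by
  classical
  have h := S.card_correct_mul_le d r
  have hpos : 0 < Nat.card (Library N B) := Nat.card_pos
  have hsplit : Nat.card {W : Library N B // ∀ k, S.output d W k = W (d k)} +
      Nat.card {W : Library N B // ∃ k, S.output d W k ≠ W (d k)} = Nat.card (Library N B) := by
    rw [← Nat.card_sum]
    refine Nat.card_congr ((Equiv.sumCongr (Equiv.refl _) (Equiv.subtypeEquivRight ?_)).trans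
      (Equiv.sumCompl fun W : Library N B => ∀ k, S.output d W k = W (d k)))
    exact fun W => not_forall.symm
  rw [errorProb, div_le_iff₀ (by exact_mod_cast hpos)] at hS
  have hbad : 2 * Nat.card {W : Library N B // ∃ k, S.output d W k ≠ W (d k)} ≤
      Nat.card (Library N B) := by
    have : 2 * (Nat.card {W : Library N B // ∃ k, S.output d W k ≠ W (d k)} : ℝ) ≤
      Nat.card (Library N B) := by linarith
    exact_mod_cast this
  refine (Nat.pow_le_pow_iff_right one_lt_two).mp
    (Nat.le_of_mul_le_mul_right (c := Nat.card (Library N B)) ?_ hpos)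
  calc 2 ^ (S.acyclicBits d r).card * Nat.card (Library N B)
      ≤ 2 ^ (S.acyclicBits d r).card *
        (2 * Nat.card {W : Library N B // ∀ k, S.output d W k = W (d k)}) :=
        Nat.mul_le_mul_left _ (by omega)
    _ = 2 * (Nat.card {W : Library N B // ∀ k, S.output d W k = W (d k)} *
        2 ^ (S.acyclicBits d r).card) := by ring
    _ ≤ 2 * (2 ^ S.len d * Nat.card (Library N B)) := Nat.mul_le_mul_left _ h
    _ = _ := by ring

theorem len_le_delay_mul [Finite ι] (S : CachingScheme N B γ) (hB : 0 < B) (d : ι ↪ Fin N) :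
    (S.len d : ℝ) ≤ S.delay * B := by
  have hB' : (0 : ℝ) < B := by exact_mod_cast hB
  rw [← div_le_iff₀ hB']
  exact le_ciSup (f := fun d : ι ↪ Fin N => (S.len d : ℝ) / B) (Set.finite_range _).bddAbove d

open Classical in
theorem sum_le_card_acyclicBits [Fintype ι] (S : CachingScheme N B γ) (d : ι ↪ Fin N)
    (r : ι → ℕ) :
    ∑ u, ∑ b, (if ∀ v, r v ≤ r u → (d u, b) ∉ S.cache v then (1 : ℝ) else 0) ≤
      (S.acyclicBits d r).card := by
  rw [← Fintype.sum_prod_type'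
    (f := fun u b => if ∀ v, r v ≤ r u → (d u, b) ∉ S.cache v then (1 : ℝ) else 0),
    Finset.sum_boole]
  norm_cast
  refine Finset.card_le_card_of_injOn (fun q => (d q.1, q.2)) (fun q hq => ?_) ?_
  · simp only [Finset.coe_filter, Finset.mem_univ, true_and, Set.mem_ofPred_eq] at hq
    exact mem_acyclicBits.mpr ⟨q.1, rfl, hq⟩
  · rintro ⟨u, b⟩ - ⟨u', b'⟩ - h
    simp only [Prod.mk.injEq, EmbeddingLike.apply_eq_iff_eq] at h
    exact Prod.ext h.1 h.2

end CachingScheme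

/-! ### The lower convex envelope -/

/-- Every point of the convex hull lies above the convex curve through the given points. -/
theorem le_of_mem_convexHull_delay {K : ℕ} {p : ℝ × ℝ}
    (hp : p ∈ convexHull ℝ
      {p : ℝ × ℝ | ∃ t : ℕ, t ≤ K ∧ p = ((t : ℝ), ((K : ℝ) - t) / (1 + t))}) :
    (0 ≤ p.1 ∧ p.1 ≤ K) ∧ ((K : ℝ) - p.1) / (1 + p.1) ≤ p.2 := by
  have hconv : ConvexOn ℝ (Set.Icc (0 : ℝ) K) fun x => ((K : ℝ) - x) / (1 + x) := by
    refine ⟨convex_Icc _ _, fun x hx y hy a b ha hb hab => ?_⟩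
    obtain rfl : b = 1 - a := by linarith
    have hx1 : 0 < 1 + x := by linarith [hx.1]
    have hy1 : 0 < 1 + y := by linarith [hy.1]
    have hz : 0 < 1 + (a * x + (1 - a) * y) := by
      have := mul_nonneg ha hx.1
      have := mul_nonneg hb hy.1
      linarith
    simp only [smul_eq_mul]
    have key : a * ((K - x) / (1 + x)) + (1 - a) * ((K - y) / (1 + y)) -
        (K - (a * x + (1 - a) * y)) / (1 + (a * x + (1 - a) * y)) =
        (K + 1) * (a * (1 - a) * (x - y) ^ 2) /
          ((1 + x) * (1 + y) * (1 + (a * x + (1 - a) * y))) := by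
      field_simp
      ring
    have : 0 ≤ (K + 1) * (a * (1 - a) * (x - y) ^ 2) /
          ((1 + x) * (1 + y) * (1 + (a * x + (1 - a) * y))) := by positivity
    linarith
  refine convexHull_min ?_ hconv.convex_epigraph hp
  rintro _ ⟨t, ht, rfl⟩
  exact ⟨⟨t.cast_nonneg, Nat.cast_le.mpr ht⟩, le_rfl⟩

theorem bddBelow_delayEnvelope (K : ℕ) (x : ℝ) :
    BddBelow {y : ℝ | (x, y) ∈ convexHull ℝ
      {p : ℝ × ℝ | ∃ t : ℕ, t ≤ K ∧ p = ((t : ℝ), ((K : ℝ) - t) / (1 + t))}} := by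
  refine ⟨0, fun y hy => ?_⟩
  obtain ⟨⟨h0, hK⟩, h⟩ := le_of_mem_convexHull_delay hy
  exact (div_nonneg (sub_nonneg.mpr hK) (by simp only at h0; linarith)).trans h

/-- The envelope is decreasing, so a point of the hull above a smaller abscissa bounds it too. -/
theorem delayEnvelope_le {K : ℕ} {x₀ y₀ x : ℝ}
    (h : (x₀, y₀) ∈ convexHull ℝ
      {p : ℝ × ℝ | ∃ t : ℕ, t ≤ K ∧ p = ((t : ℝ), ((K : ℝ) - t) / (1 + t))})
    (hx : x₀ ≤ x) (hxK : x ≤ K) : delayEnvelope K x ≤ y₀ := by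
  obtain ⟨⟨h0, hK⟩, hy⟩ := le_of_mem_convexHull_delay h
  simp only at h0 hK hy
  have hy0 : 0 ≤ y₀ := (div_nonneg (sub_nonneg.mpr hK) (by linarith)).trans hy
  rcases hx.eq_or_lt with rfl | hlt
  · exact csInf_le (bddBelow_delayEnvelope K _) h
  -- Move from `(x₀, y₀)` towards the point `(K, 0)`.
  have hlast : ((K : ℝ), (0 : ℝ)) ∈ convexHull ℝ
      {p : ℝ × ℝ | ∃ t : ℕ, t ≤ K ∧ p = ((t : ℝ), ((K : ℝ) - t) / (1 + t))} :=
    subset_convexHull ℝ _ ⟨K, le_rfl, by simp⟩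
  have hpos : 0 < (K : ℝ) - x₀ := by linarith
  have hmem := (convex_convexHull ℝ _) h hlast
    (a := (K - x) / (K - x₀)) (b := (x - x₀) / (K - x₀))
    (div_nonneg (by linarith) hpos.le) (div_nonneg (by linarith) hpos.le)
    (by rw [← add_div, div_eq_one_iff_eq hpos.ne']; ring)
  have hpt : ((K - x) / (K - x₀)) • (x₀, y₀) + ((x - x₀) / (K - x₀)) • ((K : ℝ), (0 : ℝ)) =
      (x, (K - x) / (K - x₀) * y₀) := by
    ext
    · simp only [Prod.smul_mk, smul_eq_mul, Prod.mk_add_mk]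
      field_simp
      ring
    · simp
  rw [hpt] at hmem
  refine (csInf_le (bddBelow_delayEnvelope K x) hmem).trans ?_
  exact mul_le_of_le_one_left hy0 ((div_le_one hpos).mpr (by linarith))

theorem delayEnvelope_natCast {K t : ℕ} (ht : t ≤ K) :
    delayEnvelope K t = ((K : ℝ) - t) / (1 + t) := by
  have hmem : ((t : ℝ), ((K : ℝ) - t) / (1 + t)) ∈ convexHull ℝ
      {p : ℝ × ℝ | ∃ t : ℕ, t ≤ K ∧ p = ((t : ℝ), ((K : ℝ) - t) / (1 + t))} :=
    subset_convexHull ℝ _ ⟨t, ht, rfl⟩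
  refine le_antisymm (csInf_le (bddBelow_delayEnvelope K _) hmem) ?_
  exact le_csInf ⟨_, hmem⟩ fun y hy => (le_of_mem_convexHull_delay hy).2

theorem exists_mem_convexHull_lt {K : ℕ} {x T : ℝ} (hx : 0 ≤ x) (hxK : x ≤ K)
    (hT : delayEnvelope K x < T) :
    ∃ y < T, (x, y) ∈ convexHull ℝ
      {p : ℝ × ℝ | ∃ t : ℕ, t ≤ K ∧ p = ((t : ℝ), ((K : ℝ) - t) / (1 + t))} := by
  have hne : {y : ℝ | (x, y) ∈ convexHull ℝ
      {p : ℝ × ℝ | ∃ t : ℕ, t ≤ K ∧ p = ((t : ℝ), ((K : ℝ) - t) / (1 + t))}}.Nonempty := by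
    have h0 : ((0 : ℝ), (K : ℝ)) ∈ convexHull ℝ
        {p : ℝ × ℝ | ∃ t : ℕ, t ≤ K ∧ p = ((t : ℝ), ((K : ℝ) - t) / (1 + t))} :=
      subset_convexHull ℝ _ ⟨0, K.zero_le, by simp⟩
    have hK : ((K : ℝ), (0 : ℝ)) ∈ convexHull ℝ
        {p : ℝ × ℝ | ∃ t : ℕ, t ≤ K ∧ p = ((t : ℝ), ((K : ℝ) - t) / (1 + t))} :=
      subset_convexHull ℝ _ ⟨K, le_rfl, by simp⟩
    rcases K.eq_zero_or_pos with rfl | hpos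
    · obtain rfl : x = 0 := le_antisymm (by simpa using hxK) hx
      exact ⟨_, h0⟩
    have hpos' : (0 : ℝ) < K := by exact_mod_cast hpos
    have hmem := (convex_convexHull ℝ _) h0 hK (a := 1 - x / K) (b := x / K)
      (by rw [sub_nonneg, div_le_one hpos']; exact hxK) (by positivity) (by ring)
    refine ⟨(1 - x / K) * K, ?_⟩
    have hpt : (1 - x / K) • ((0 : ℝ), (K : ℝ)) + (x / K) • ((K : ℝ), (0 : ℝ)) =
        (x, (1 - x / K) * K) := by
      ext
      · simp [hpos'.ne']
      · simp
    rwa [hpt] at hmem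
  obtain ⟨y, hy, hyT⟩ := exists_lt_of_csInf_lt hne hT
  exact ⟨y, hyT, hy⟩

/-! ### The converse -/

theorem cache_inr_eq_empty {K₁ K₂ N B : ℕ} {γ₁ : ℝ}
    (S : CachingScheme N B (cacheSizes K₁ K₂ γ₁)) (v : Fin K₂) : S.cache (Sum.inr v) = ∅ := by
  have h := S.card_cache_le (Sum.inr v)
  simp only [cacheSizes, Sum.elim_inr, zero_mul] at h
  exact Finset.card_eq_zero.mp (by exact_mod_cast le_antisymm h (Nat.cast_nonneg _))

/-- The acyclic bound, averaged over all demands and all orders in which the users with a cache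
follow those without: a bit cached by `s` users contributes `(K₁ - s) / (1 + s)`. -/
theorem sum_bits_le {K₁ K₂ N B : ℕ} {γ₁ c : ℝ} (hN : K₁ + K₂ ≤ N) (hB : 0 < B)
    (S : CachingScheme N B (cacheSizes K₁ K₂ γ₁))
    (hS : ∀ d r, ((S.acyclicBits d r).card : ℝ) ≤ S.len d + c) :
    ∑ p : Fin N × Fin B,
        ((K₁ : ℝ) - (Finset.univ.filter fun v => p ∈ S.cache (Sum.inl v)).card) /
          (1 + (Finset.univ.filter fun v => p ∈ S.cache (Sum.inl v)).card) ≤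
      N * (S.delay * B + c - K₂ * B) := by
  classical
  set C : Fin N × Fin B → Finset (Fin K₁) :=
    fun p => Finset.univ.filter fun v => p ∈ S.cache (Sum.inl v) with hC
  let ind (π : Equiv.Perm (Fin K₁)) (u : Fin K₁) (p : Fin N × Fin B) : ℝ :=
    if ∀ v, π v ≤ π u → v ∉ C p then 1 else 0
  have hpoint : ∀ (d : Fin K₁ ⊕ Fin K₂ ↪ Fin N) (π : Equiv.Perm (Fin K₁)),
      ∑ u, ∑ b, ind π u (d (Sum.inl u), b) ≤ S.delay * B + c - K₂ * B := by
    intro d π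
    -- Users without a cache come first; their whole files then count.
    let r : Fin K₁ ⊕ Fin K₂ → ℕ := Sum.elim (fun u => (π u : ℕ) + 1) fun _ => 0
    have h := (S.sum_le_card_acyclicBits d r).trans
      ((hS d r).trans (add_le_add_left (S.len_le_delay_mul hB d) c))
    rw [Fintype.sum_sum_type] at h
    have hinr : ∑ u : Fin K₂, ∑ b, (if ∀ v, r v ≤ r (Sum.inr u) →
        (d (Sum.inr u), b) ∉ S.cache v then (1 : ℝ) else 0) = K₂ * B := by
      have : ∀ (u : Fin K₂) (b : Fin B), ∀ v, r v ≤ r (Sum.inr u) →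
          (d (Sum.inr u), b) ∉ S.cache v := by
        rintro u b (v | v) hv
        · simp [r] at hv
        · simp [cache_inr_eq_empty]
      simp only [if_pos (this _ _), Finset.sum_const, Finset.card_univ, Fintype.card_fin,
        nsmul_eq_mul, mul_one]
    have hinl : ∑ u : Fin K₁, ∑ b, (if ∀ v, r v ≤ r (Sum.inl u) →
        (d (Sum.inl u), b) ∉ S.cache v then (1 : ℝ) else 0) =
        ∑ u, ∑ b, ind π u (d (Sum.inl u), b) := by
      refine Finset.sum_congr rfl fun u _ => Finset.sum_congr rfl fun b _ => ?_
      refine if_congr ?_ rfl rfl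
      simp [r, hC, cache_inr_eq_empty]
    rw [hinr, hinl] at h
    linarith
  have hfact : (0 : ℝ) < K₁.factorial := by exact_mod_cast K₁.factorial_pos
  have hemb : (0 : ℝ) < Fintype.card (Fin K₁ ⊕ Fin K₂ ↪ Fin N) := by
    have : Nonempty (Fin K₁ ⊕ Fin K₂ ↪ Fin N) :=
      Function.Embedding.nonempty_of_card_le (by simpa using hN)
    exact_mod_cast Fintype.card_pos
  have htotal : ∑ d : Fin K₁ ⊕ Fin K₂ ↪ Fin N, ∑ π : Equiv.Perm (Fin K₁),
      ∑ u, ∑ b, ind π u (d (Sum.inl u), b) ≤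
      Fintype.card (Fin K₁ ⊕ Fin K₂ ↪ Fin N) *
        (K₁.factorial * (S.delay * B + c - K₂ * B)) := by
    refine (Finset.sum_le_sum fun d _ => Finset.sum_le_sum fun π _ => hpoint d π).trans_eq ?_
    simp only [Finset.sum_const, Finset.card_univ, Fintype.card_perm, Fintype.card_fin,
      nsmul_eq_mul]
  have havg : (N : ℝ) * ∑ d : Fin K₁ ⊕ Fin K₂ ↪ Fin N, ∑ π : Equiv.Perm (Fin K₁),
      ∑ u, ∑ b, ind π u (d (Sum.inl u), b) =
      Fintype.card (Fin K₁ ⊕ Fin K₂ ↪ Fin N) * (K₁.factorial *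
        ∑ p : Fin N × Fin B, ((K₁ : ℝ) - (C p).card) / (1 + (C p).card)) := by
    calc _ = ∑ π : Equiv.Perm (Fin K₁), ∑ u, (N : ℝ) * ∑ d : Fin K₁ ⊕ Fin K₂ ↪ Fin N,
          ∑ b, ind π u (d (Sum.inl u), b) := by
          simp only [← Finset.mul_sum]
          rw [Finset.sum_comm]
          congr 1
          exact Finset.sum_congr rfl fun π _ => Finset.sum_comm
      _ = ∑ π : Equiv.Perm (Fin K₁), ∑ u, Fintype.card (Fin K₁ ⊕ Fin K₂ ↪ Fin N) *
          ∑ p, ind π u p := by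
          refine Finset.sum_congr rfl fun π _ => Finset.sum_congr rfl fun u _ => ?_
          rw [mul_sum_embedding_apply (Sum.inl u) fun n => ∑ b, ind π u (n, b),
            Fintype.sum_prod_type]
      _ = _ := by
          simp only [← Finset.mul_sum]
          congr 1
          rw [Finset.mul_sum, ← Finset.sum_congr rfl fun p _ => sum_perm_sum_before (C p)]
          conv_rhs => rw [Finset.sum_comm]
          refine Finset.sum_congr rfl fun π _ => ?_
          rw [Finset.sum_comm]
  have h := havg ▸ mul_le_mul_of_nonneg_left htotal (Nat.cast_nonneg (α := ℝ) N)
  rw [mul_left_comm (N : ℝ), mul_left_comm (N : ℝ)] at h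
  exact le_of_mul_le_mul_left (le_of_mul_le_mul_left h hemb) hfact

theorem delayEnvelope_add_le_delay {K₁ K₂ N B : ℕ} {γ₁ c : ℝ} (hγ₀ : 0 ≤ γ₁) (hγ₁ : γ₁ ≤ 1)
    (hN : K₁ + K₂ ≤ N) (hB : 0 < B) (hc : 0 ≤ c)
    (S : CachingScheme N B (cacheSizes K₁ K₂ γ₁))
    (hS : ∀ d r, ((S.acyclicBits d r).card : ℝ) ≤ S.len d + c) :
    delayEnvelope K₁ (K₁ * γ₁) + K₂ ≤ S.delay + c / B := by
  classical
  have hx0 : 0 ≤ (K₁ : ℝ) * γ₁ := by positivity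
  have hxK : (K₁ : ℝ) * γ₁ ≤ K₁ := mul_le_of_le_one_right (Nat.cast_nonneg _) hγ₁
  have hB' : (0 : ℝ) < B := by exact_mod_cast hB
  rcases N.eq_zero_or_pos with rfl | hNpos
  · -- Without files there are no users, and nothing to send.
    obtain ⟨rfl, rfl⟩ : K₁ = 0 ∧ K₂ = 0 := by omega
    have henv : delayEnvelope 0 ((0 : ℕ) * γ₁) ≤ 0 := by
      refine delayEnvelope_le (x₀ := 0) (subset_convexHull ℝ _ ⟨0, le_rfl, by simp⟩) hx0 hxK
    have hdelay : 0 ≤ S.delay := Real.iSup_nonneg fun d => by positivity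
    have := div_nonneg hc hB'.le
    push_cast at henv ⊢
    linarith
  have hN' : (0 : ℝ) < N := by exact_mod_cast hNpos
  have hsum := sum_bits_le hN hB S hS
  set s : Fin N × Fin B → ℕ :=
    fun p => (Finset.univ.filter fun v => p ∈ S.cache (Sum.inl v)).card with hs
  -- The uniform average over all bits is a point of the convex hull.
  have hmem : ((∑ p, (s p : ℝ)) / (N * B), (∑ p, ((K₁ : ℝ) - s p) / (1 + s p)) / (N * B)) ∈
      convexHull ℝ {p : ℝ × ℝ | ∃ t : ℕ, t ≤ K₁ ∧ p = ((t : ℝ), ((K₁ : ℝ) - t) / (1 + t))} := by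
    refine mem_convexHull_of_exists_fintype (ι := Fin N × Fin B) (fun _ => 1 / ((N : ℝ) * B))
      (fun p => ((s p : ℝ), ((K₁ : ℝ) - s p) / (1 + s p))) (fun _ => by positivity) ?_
      (fun p => ⟨s p, ?_, rfl⟩) ?_
    · simp only [Finset.sum_const, Finset.card_univ, Fintype.card_prod, Fintype.card_fin,
        nsmul_eq_mul, Nat.cast_mul]
      exact mul_one_div_cancel (by positivity)
    · simpa [hs] using Finset.card_le_univ (Finset.univ.filter fun v => p ∈ S.cache (Sum.inl v))
    · ext
      · simp [Prod.fst_sum, ← Finset.mul_sum, div_eq_inv_mul]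
      · simp [Prod.snd_sum, ← Finset.mul_sum, div_eq_inv_mul]
  have hcache : ∑ p, (s p : ℝ) ≤ K₁ * γ₁ * (N * B) := by
    calc ∑ p, (s p : ℝ) = ∑ v : Fin K₁, ((S.cache (Sum.inl v)).card : ℝ) := by
          simp only [hs, Finset.natCast_card_filter]
          rw [Finset.sum_comm]
          simp
      _ ≤ ∑ _v : Fin K₁, γ₁ * ((N : ℝ) * B) :=
          Finset.sum_le_sum fun v _ => S.card_cache_le (Sum.inl v)
      _ = _ := by simp; ring
  have henv := delayEnvelope_le hmem ((div_le_iff₀ (by positivity)).mpr hcache) hxK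
  have hle : (∑ p, ((K₁ : ℝ) - s p) / (1 + s p)) / (N * B) ≤ S.delay + c / B - K₂ := by
    rw [div_le_iff₀ (by positivity)]
    refine hsum.trans_eq ?_
    field_simp
  linarith

/-! ### Coded delivery -/

/-- The indices of the bits of a file that is split into subfiles `j : J`, where subfile `j` has
one bit for every set of `t j` users. -/
abbrev SubfileIndex {J : Type} (K : ℕ) (t : J → ℕ) : Type :=
  Σ j : J, {S : Finset (Fin K) // S.card = t j}

theorem card_subfileIndex {J : Type} [Fintype J] (K : ℕ) (t : J → ℕ) :
    Fintype.card (SubfileIndex K t) = ∑ j, K.choose (t j) := by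
  simp [Fintype.card_sigma]

section CodedDelivery

variable {K₁ K₂ N B L : ℕ} {J : Type} {t : J → ℕ}

/-- The bit of file `n` with index `(j, S)`, as an element of `ZMod 2`; zero if there is none. -/
def subfileBit (e : Fin B ≃ SubfileIndex K₁ t) (W : Library N B) (n : Fin N) (j : J)
    (S : Finset (Fin K₁)) : ZMod 2 :=
  if h : S.card = t j then ((W n (e.symm ⟨j, S, h⟩)).toNat : ZMod 2) else 0

/-- What user `k` knows of the library: the cached bits, and zero elsewhere. -/
def knownLibrary (e : Fin B ≃ SubfileIndex K₁ t) (k : Fin K₁)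
    (Z : {p : Fin N × Fin B // k ∈ (e p.2).2.1} → Bool) : Library N B :=
  fun n b => if h : k ∈ (e b).2.1 then Z ⟨(n, b), h⟩ else false

theorem subfileBit_knownLibrary (e : Fin B ≃ SubfileIndex K₁ t) (W : Library N B) (n : Fin N)
    (j : J) {S : Finset (Fin K₁)} {k : Fin K₁} (hk : k ∈ S) :
    subfileBit e (knownLibrary e k fun p => W p.1.1 p.1.2) n j S = subfileBit e W n j S := by
  unfold subfileBit knownLibrary
  by_cases h : S.card = t j
  · have hmem : k ∈ (e (e.symm ⟨j, S, h⟩)).2.1 := by rwa [e.apply_symm_apply]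
    rw [dif_pos h, dif_pos h, dif_pos hmem]
  · rw [dif_neg h, dif_neg h]

theorem natCast_toNat_decide_eq_one (z : ZMod 2) :
    (((decide (z = 1)).toNat : ℕ) : ZMod 2) = z := by
  revert z; decide

theorem decide_natCast_toNat_eq_one (b : Bool) : decide (((b.toNat : ℕ) : ZMod 2) = 1) = b := by
  revert b; decide

/-- User `k` caches the bits `(j, S)` with `k ∈ S` of all files. For every subfile `j` and every
set `S` of `t j + 1` users, the transmitter sends the sum over `k ∈ S` of the bit `(j, S \ {k})`
requested by `k`, all of whose other terms are known to `k`. The users without a cache are sent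
their files as they are. -/
def codedScheme {γ₁ : ℝ} (e : Fin B ≃ SubfileIndex K₁ t)
    (m : Fin L ≃ SubfileIndex K₁ (fun j => t j + 1) ⊕ (Fin K₂ × Fin B))
    (hcache : ∀ k : Fin K₁, (N : ℝ) *
      (Finset.univ.filter fun b => k ∈ (e b).2.1).card ≤ γ₁ * (N * B)) :
    CachingScheme N B (cacheSizes K₁ K₂ γ₁) where
  cache := Sum.elim (fun k => Finset.univ.filter fun p => k ∈ (e p.2).2.1) fun _ => ∅
  card_cache_le := by
    rintro (k | k)
    · have hset : (Finset.univ.filter fun p : Fin N × Fin B => k ∈ (e p.2).2.1) =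
          Finset.univ ×ˢ Finset.univ.filter fun b => k ∈ (e b).2.1 := by
        ext; simp
      have h := hcache k
      simpa only [Sum.elim_inl, hset, Finset.card_product, Finset.card_univ, Fintype.card_fin,
        Nat.cast_mul, cacheSizes] using h
    · simp [cacheSizes]
  len _ := L
  encode d W i := Sum.elim
    (fun q : SubfileIndex K₁ (fun j => t j + 1) =>
      decide (∑ k ∈ q.2.1, subfileBit e W (d (Sum.inl k)) q.1 (q.2.1.erase k) = 1))
    (fun q => W (d (Sum.inr q.1)) q.2) (m i)
  decode d k := match k with
    | Sum.inr k => fun X _ b => X (m.symm (Sum.inr (k, b)))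
    | Sum.inl k => fun X Z b =>
      let V : Library N B := knownLibrary e k fun p => Z ⟨p.1, by simpa using p.2⟩
      if h : k ∈ (e b).2.1 then V (d (Sum.inl k)) b
      else decide (((X (m.symm (Sum.inl ⟨(e b).1, insert k (e b).2.1, by
        rw [Finset.card_insert_of_notMem h, (e b).2.2]⟩))).toNat : ZMod 2) -
          ∑ k' ∈ (e b).2.1, subfileBit e V (d (Sum.inl k')) (e b).1
            ((insert k (e b).2.1).erase k') = 1)

theorem codedScheme_isZeroError {γ₁ : ℝ} (e : Fin B ≃ SubfileIndex K₁ t)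
    (m : Fin L ≃ SubfileIndex K₁ (fun j => t j + 1) ⊕ (Fin K₂ × Fin B))
    (hcache : ∀ k : Fin K₁, (N : ℝ) *
      (Finset.univ.filter fun b => k ∈ (e b).2.1).card ≤ γ₁ * (N * B)) :
    (codedScheme e m hcache).IsZeroError := by
  rintro d W (k | k)
  · funext b
    by_cases h : k ∈ (e b).2.1
    · simp [CachingScheme.output, codedScheme, h, knownLibrary]
    · have hown : subfileBit e W (d (Sum.inl k)) (e b).1 (e b).2.1 =
          ((W (d (Sum.inl k)) b).toNat : ZMod 2) := by
        rw [subfileBit, dif_pos (e b).2.2]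
        simp
      have hothers : ∑ k' ∈ (e b).2.1, subfileBit e (knownLibrary e k fun p => W p.1.1 p.1.2)
            (d (Sum.inl k')) (e b).1 ((insert k (e b).2.1).erase k') =
          ∑ k' ∈ (e b).2.1, subfileBit e W
            (d (Sum.inl k')) (e b).1 ((insert k (e b).2.1).erase k') := by
        refine Finset.sum_congr rfl fun k' hk' => subfileBit_knownLibrary e W _ _ ?_
        exact Finset.mem_erase.mpr ⟨fun hkk => h (hkk ▸ hk'), Finset.mem_insert_self _ _⟩
      simp only [CachingScheme.output, codedScheme, h, dif_neg, not_false_eq_true,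
        Equiv.apply_symm_apply, Sum.elim_inl, natCast_toNat_decide_eq_one]
      rw [hothers, Finset.sum_insert h, Finset.erase_insert h, hown, add_sub_cancel_right,
        decide_natCast_toNat_eq_one]
  · funext b
    simp [CachingScheme.output, codedScheme]

end CodedDelivery

theorem mul_card_filter_mem {K t : ℕ} (k : Fin K) :
    K * (Finset.univ.filter fun S : {S : Finset (Fin K) // S.card = t} => k ∈ S.1).card =
      K.choose t * t := by
  classical
  have hcompl : (Finset.univ.filter
      fun S : {S : Finset (Fin K) // S.card = t} => k ∉ S.1).card = (K - 1).choose t := by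
    have h : (Finset.powersetCard t (Finset.univ.erase k)).card = (K - 1).choose t := by
      rw [Finset.card_powersetCard, Finset.card_erase_of_mem (Finset.mem_univ k),
        Finset.card_univ, Fintype.card_fin]
    rw [← h]
    refine Finset.card_bij (fun S _ => S.1) (fun S hS => ?_) (fun S _ S' _ => Subtype.ext)
      fun S hS => ?_
    · rw [Finset.mem_powersetCard, Finset.subset_erase]
      exact ⟨⟨Finset.subset_univ _, (Finset.mem_filter.mp hS).2⟩, S.2⟩
    · rw [Finset.mem_powersetCard, Finset.subset_erase] at hS
      exact ⟨⟨S, hS.2⟩, Finset.mem_filter.mpr ⟨Finset.mem_univ _, hS.1.2⟩, rfl⟩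
  have hsum := Finset.card_filter_add_card_filter_not (s := Finset.univ)
    fun S : {S : Finset (Fin K) // S.card = t} => k ∈ S.1
  rw [hcompl, Finset.card_univ, Fintype.card_finset_len, Fintype.card_fin] at hsum
  obtain ⟨K, rfl⟩ : ∃ K', K = K' + 1 := ⟨K - 1, by have := k.isLt; omega⟩
  have hpascal := Nat.choose_mul_succ_eq K t
  rw [Nat.add_sub_cancel] at hsum
  rcases le_or_gt t (K + 1) with ht | ht
  · obtain ⟨r, hr⟩ := Nat.exists_eq_add_of_le ht
    rw [show K + 1 - t = r by omega] at hpascal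
    have : (K + 1) * (Finset.univ.filter
        fun S : {S : Finset (Fin (K + 1)) // S.card = t} => k ∈ S.1).card +
        K.choose t * (K + 1) = (K + 1).choose t * t + K.choose t * (K + 1) := by
      calc _ = (K + 1).choose t * (K + 1) := by rw [← hsum]; ring
        _ = _ := by rw [hpascal, ← mul_add, ← hr]
    exact Nat.add_right_cancel this
  · rw [Nat.choose_eq_zero_of_lt ht] at hsum ⊢
    rw [Nat.eq_zero_of_add_eq_zero_right hsum]
    simp

/-- Coded delivery with subfiles of the levels `t j`. -/
theorem exists_isZeroError_delay_eq {K₁ K₂ N B : ℕ} {γ₁ : ℝ} (hN : K₁ + K₂ ≤ N) (hB : 0 < B)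
    {J : Type} [Fintype J] (t : J → ℕ) (hsize : ∑ j, K₁.choose (t j) = B)
    (hcache : ∑ j, ((K₁.choose (t j) : ℝ) * t j) ≤ K₁ * γ₁ * B) :
    ∃ S : CachingScheme N B (cacheSizes K₁ K₂ γ₁), S.IsZeroError ∧
      S.delay = (∑ j, (K₁.choose (t j + 1) : ℝ)) / B + K₂ := by
  classical
  have e : Fin B ≃ SubfileIndex K₁ t :=
    (Fintype.equivFinOfCardEq ((card_subfileIndex K₁ t).trans hsize)).symm
  have m : Fin (∑ j, K₁.choose (t j + 1) + K₂ * B) ≃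
      SubfileIndex K₁ (fun j => t j + 1) ⊕ (Fin K₂ × Fin B) :=
    (Fintype.equivFinOfCardEq (by
      rw [Fintype.card_sum, card_subfileIndex]; simp)).symm
  have hk : ∀ k : Fin K₁, (N : ℝ) *
      (Finset.univ.filter fun b => k ∈ (e b).2.1).card ≤ γ₁ * (N * B) := by
    intro k
    have hcard : (Finset.univ.filter fun b => k ∈ (e b).2.1).card =
        ∑ j, (Finset.univ.filter
          fun S : {S : Finset (Fin K₁) // S.card = t j} => k ∈ S.1).card := by
      rw [← Finset.card_sigma]
      exact Finset.card_equiv e fun b => by simp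
    have hK : (0 : ℝ) < K₁ := by exact_mod_cast (Nat.zero_le _).trans_lt k.isLt
    have hmul : (K₁ : ℝ) * (Finset.univ.filter fun b => k ∈ (e b).2.1).card =
        ∑ j, ((K₁.choose (t j) : ℝ) * t j) := by
      rw [hcard]
      push_cast
      rw [Finset.mul_sum]
      exact Finset.sum_congr rfl fun j _ => by exact_mod_cast mul_card_filter_mem k
    have hle : ((Finset.univ.filter fun b => k ∈ (e b).2.1).card : ℝ) ≤ γ₁ * B := by
      refine le_of_mul_le_mul_left ?_ hK
      rw [hmul, ← mul_assoc]
      exact hcache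
    calc _ ≤ (N : ℝ) * (γ₁ * B) := mul_le_mul_of_nonneg_left hle (Nat.cast_nonneg _)
      _ = _ := by ring
  refine ⟨codedScheme e m hk, codedScheme_isZeroError e m hk, ?_⟩
  have : Nonempty (Fin K₁ ⊕ Fin K₂ ↪ Fin N) :=
    Function.Embedding.nonempty_of_card_le (by simpa using hN)
  have hB' : (B : ℝ) ≠ 0 := by exact_mod_cast hB.ne'
  simp only [CachingScheme.delay, codedScheme, ciSup_const]
  push_cast
  field_simp

theorem choose_succ_eq_mul_div {K t : ℕ} (ht : t ≤ K) :
    (K.choose (t + 1) : ℝ) = K.choose t * (((K : ℝ) - t) / (1 + t)) := by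
  have h : (K.choose (t + 1) : ℝ) * (t + 1) = K.choose t * ((K : ℝ) - t) := by
    rw [← Nat.cast_sub ht]
    exact_mod_cast Nat.choose_succ_right_eq K t
  rw [mul_div_assoc', eq_div_iff (by positivity), ← h]
  ring

/-- Memory sharing: for large files, every delay above the envelope is achieved without errors by
splitting the files into subfiles of several levels. -/
theorem eventually_exists_isZeroError {K₁ K₂ N : ℕ} {γ₁ T : ℝ} (hγ₀ : 0 ≤ γ₁) (hγ₁ : γ₁ ≤ 1)
    (hN : K₁ + K₂ ≤ N) (hT : delayEnvelope K₁ (K₁ * γ₁) + K₂ < T) :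
    ∀ᶠ B : ℕ in Filter.atTop, 0 < B ∧ ∃ S : CachingScheme N B (cacheSizes K₁ K₂ γ₁),
      S.IsZeroError ∧ S.delay ≤ T := by
  obtain ⟨y, hyT, hy⟩ := exists_mem_convexHull_lt (K := K₁) (x := K₁ * γ₁) (T := T - K₂)
    (by positivity) (mul_le_of_le_one_right (Nat.cast_nonneg _) hγ₁) (by linarith)
  obtain ⟨ι, _, w, z, hw0, hw1, hz, hwz⟩ := mem_convexHull_iff_exists_fintype.mp hy
  choose t ht hzt using hz
  have hx : ∑ i, w i * t i = K₁ * γ₁ := by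
    simpa [hzt, Prod.fst_sum] using congrArg Prod.fst hwz
  have hy' : ∑ i, w i * (((K₁ : ℝ) - t i) / (1 + t i)) = y := by
    simpa [hzt, Prod.snd_sum] using congrArg Prod.snd hwz
  have hch : ∀ i, (0 : ℝ) < K₁.choose (t i) := fun i => by
    exact_mod_cast Nat.choose_pos (ht i)
  set c : ℝ := ∑ i, (K₁.choose (t i) : ℝ)
  have hlim : Filter.Tendsto (fun B : ℕ => c * K₁ / (B : ℝ)) Filter.atTop (nhds 0) :=
    tendsto_const_div_atTop_nhds_zero_nat _
  filter_upwards [Filter.eventually_gt_atTop 0,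
    hlim.eventually_le_const (sub_pos.mpr hyT)] with B hB hBT
  refine ⟨hB, ?_⟩
  have hB' : (0 : ℝ) < B := by exact_mod_cast hB
  -- The fraction `w i` of each file is cut into `n i` subfiles of level `t i`, up to rounding.
  let n (i : ι) : ℕ := ⌊w i * B / K₁.choose (t i)⌋₊
  have hnle : ∀ i, (n i : ℝ) * K₁.choose (t i) ≤ w i * B := fun i =>
    (le_div_iff₀ (hch i)).mp (Nat.floor_le (by have := hw0 i; positivity))
  have hnge : ∀ i, w i * B ≤ n i * K₁.choose (t i) + K₁.choose (t i) := fun i => by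
    have := (div_le_iff₀ (hch i)).mp (Nat.lt_floor_add_one (w i * B / K₁.choose (t i))).le
    linarith
  have hsum : ∑ i, n i * K₁.choose (t i) ≤ B := by
    have : ∑ i, (n i : ℝ) * K₁.choose (t i) ≤ B := by
      refine (Finset.sum_le_sum fun i _ => hnle i).trans_eq ?_
      rw [← Finset.sum_mul, hw1, one_mul]
    exact_mod_cast this
  -- The boundedly many bits that are left over are not cached: they have level zero.
  obtain ⟨r, hr⟩ := Nat.exists_eq_add_of_le hsum
  have hrle : (r : ℝ) ≤ c := by
    have h1 : (B : ℝ) = ∑ i, (n i : ℝ) * K₁.choose (t i) + r := by exact_mod_cast hr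
    have h2 : (B : ℝ) ≤ ∑ i, (n i : ℝ) * K₁.choose (t i) + c := by
      rw [← Finset.sum_add_distrib, ← one_mul (B : ℝ), ← hw1, Finset.sum_mul]
      exact Finset.sum_le_sum fun i _ => hnge i
    linarith
  obtain ⟨S, hS, hdelay⟩ := exists_isZeroError_delay_eq (K₂ := K₂) (γ₁ := γ₁) hN hB
    (Sum.elim (fun q : Σ i, Fin (n i) => t q.1) fun _ : Fin r => 0)
    (by simp [Fintype.sum_sum_type, Fintype.sum_sigma, hr]) (by
      simp only [Fintype.sum_sum_type, Fintype.sum_sigma, Sum.elim_inl, Sum.elim_inr,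
        Finset.sum_const, Finset.card_univ, Fintype.card_fin, nsmul_eq_mul, Nat.cast_zero,
        mul_zero, add_zero, ← mul_assoc]
      rw [← hx, Finset.sum_mul]
      refine Finset.sum_le_sum fun i _ => ?_
      calc _ ≤ w i * B * t i := mul_le_mul_of_nonneg_right (hnle i) (Nat.cast_nonneg _)
        _ = _ := by ring)
  refine ⟨S, hS, ?_⟩
  have hmsg : ∑ j, (K₁.choose (Sum.elim (fun q : Σ i, Fin (n i) => t q.1)
      (fun _ : Fin r => 0) j + 1) : ℝ) ≤ y * B + c * K₁ := by
    simp only [Fintype.sum_sum_type, Fintype.sum_sigma, Sum.elim_inl, Sum.elim_inr,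
      Finset.sum_const, Finset.card_univ, Fintype.card_fin, nsmul_eq_mul, zero_add,
      Nat.choose_one_right]
    refine add_le_add ?_ (mul_le_mul_of_nonneg_right hrle (Nat.cast_nonneg _))
    rw [← hy', Finset.sum_mul]
    refine Finset.sum_le_sum fun i _ => ?_
    have hnn : 0 ≤ ((K₁ : ℝ) - t i) / (1 + t i) :=
      div_nonneg (sub_nonneg.mpr (Nat.cast_le.mpr (ht i))) (by positivity)
    rw [choose_succ_eq_mul_div (ht i), ← mul_assoc]
    calc _ ≤ w i * B * (((K₁ : ℝ) - t i) / (1 + t i)) := mul_le_mul_of_nonneg_right (hnle i) hnn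
      _ = _ := by ring
  have hdiv := (div_le_div_iff_of_pos_right hB').mpr hmsg
  rw [add_div, mul_div_cancel_right₀ _ hB'.ne'] at hdiv
  rw [hdelay]
  linarith

/-! ### The optimal delay -/

theorem isGLB_zeroErrorDelays {K₁ K₂ N : ℕ} {γ₁ : ℝ} (hγ₀ : 0 ≤ γ₁) (hγ₁ : γ₁ ≤ 1)
    (hN : K₁ + K₂ ≤ N) :
    IsGLB (zeroErrorDelays N (cacheSizes K₁ K₂ γ₁)) (delayEnvelope K₁ (K₁ * γ₁) + K₂) := by
  constructor
  · rintro _ ⟨B, hB, S, hS, rfl⟩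
    simpa using delayEnvelope_add_le_delay hγ₀ hγ₁ hN hB le_rfl S fun d r => by
      simpa using hS.card_acyclicBits_le d r
  · refine fun b hb => le_of_forall_gt_imp_ge_of_dense fun T hT => ?_
    obtain ⟨B, hB, S, hS, hdelay⟩ := (eventually_exists_isZeroError hγ₀ hγ₁ hN hT).exists
    exact (hb ⟨B, hB, S, hS, rfl⟩).trans hdelay

theorem isGLB_achievableDelays {K₁ K₂ N : ℕ} {γ₁ : ℝ} (hγ₀ : 0 ≤ γ₁) (hγ₁ : γ₁ ≤ 1)
    (hN : K₁ + K₂ ≤ N) :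
    IsGLB (achievableDelays N (cacheSizes K₁ K₂ γ₁)) (delayEnvelope K₁ (K₁ * γ₁) + K₂) := by
  constructor
  · intro T hT
    have hlim : Filter.Tendsto (fun B : ℕ => T + 1 / (B : ℝ)) Filter.atTop (nhds (T + 0)) :=
      tendsto_const_nhds.add (tendsto_const_div_atTop_nhds_zero_nat 1)
    rw [add_zero] at hlim
    refine ge_of_tendsto hlim ?_
    filter_upwards [hT (1 / 2) (by norm_num), Filter.eventually_gt_atTop 0]
      with B ⟨S, hdelay, herr⟩ hB
    refine (delayEnvelope_add_le_delay hγ₀ hγ₁ hN hB zero_le_one S fun d r => ?_).trans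
      (add_le_add_left hdelay _)
    exact_mod_cast S.card_acyclicBits_le_of_errorProb_le d r (herr d)
  · refine fun b hb => le_of_forall_gt_imp_ge_of_dense fun T hT => hb fun ε hε => ?_
    filter_upwards [eventually_exists_isZeroError hγ₀ hγ₁ hN hT] with B ⟨_, S, hS, hdelay⟩
    refine ⟨S, hdelay, fun d => ?_⟩
    have hempty : IsEmpty {W : Library N B // ∃ k, S.output d W k ≠ W (d k)} :=
      ⟨fun W => W.2.elim fun k hk => hk (hS d W.1 k)⟩
    rw [CachingScheme.errorProb, Nat.card_of_isEmpty]
    simpa using hε.le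

theorem theorem1 (K₁ K₂ N : ℕ) (γ₁ : ℝ) (hγ₀ : 0 < γ₁) (hγ₁ : γ₁ < 1) (hN : K₁ + K₂ ≤ N) :
    ((∃ t : ℕ, (K₁ : ℝ) * γ₁ = t) →
      IsLeast (zeroErrorDelays N (cacheSizes K₁ K₂ γ₁))
        ((K₁ : ℝ) * (1 - γ₁) / (1 + K₁ * γ₁) + K₂) ∧
      IsGLB (achievableDelays N (cacheSizes K₁ K₂ γ₁))
        ((K₁ : ℝ) * (1 - γ₁) / (1 + K₁ * γ₁) + K₂)) ∧
    IsGLB (zeroErrorDelays N (cacheSizes K₁ K₂ γ₁)) (delayEnvelope K₁ (K₁ * γ₁) + K₂) ∧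
    IsGLB (achievableDelays N (cacheSizes K₁ K₂ γ₁)) (delayEnvelope K₁ (K₁ * γ₁) + K₂) := by
  have hzero := isGLB_zeroErrorDelays hγ₀.le hγ₁.le hN
  have hvanish := isGLB_achievableDelays hγ₀.le hγ₁.le hN
  refine ⟨?_, hzero, hvanish⟩
  rintro ⟨t, ht⟩
  have htK : t ≤ K₁ := by
    have : (t : ℝ) ≤ K₁ := ht ▸ mul_le_of_le_one_right (Nat.cast_nonneg _) hγ₁.le
    exact_mod_cast this
  have hval : (K₁ : ℝ) * (1 - γ₁) / (1 + K₁ * γ₁) = ((K₁ : ℝ) - t) / (1 + t) := by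
    rw [mul_sub, mul_one, ht]
  rw [ht, delayEnvelope_natCast htK] at hzero hvanish
  rw [hval]
  refine ⟨⟨?_, hzero.1⟩, hvanish⟩
  -- A single subfile of level `t` attains the value.
  have hpos : 0 < K₁.choose t := Nat.choose_pos htK
  obtain ⟨S, hS, hdelay⟩ := exists_isZeroError_delay_eq (K₂ := K₂) (γ₁ := γ₁) hN hpos
    (fun _ : Unit => t) (by simp) (by simp [ht, mul_comm])
  refine ⟨_, hpos, S, hS, ?_⟩
  have hpos' : (K₁.choose t : ℝ) ≠ 0 := by exact_mod_cast hpos.ne'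
  rw [hdelay, Fintype.sum_unique, choose_succ_eq_mul_div htK, mul_div_cancel_left₀ _ hpos']
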